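/- Call a tetrahedron $PQRS$ in $\mathbb{R}^3$ (degenerate tetrahedra, of zero volume, being allowed) Heronian if its six edge lengths are integers and its four face areas and its volume are rational. Every Heronian tetrahedron can be embedded congruently in the lattice $\mathbb{Z}^3$: there are points $P',Q',R',S'\in\mathbb{Z}^3$ such that each of the six distances between two of $P',Q',R',S'$ equals the distance between the corresponding two of $P,Q,R,S$. -/

import Mathlib

/-- Area of the (possibly degenerate) triangle with the given vertices: the two-dimensional
Euclidean measure (Hausdorff measure normalised to agree with Lebesgue measure on a plane) of the
convex hull of the vertices. -/
noncomputable def triangleArea (P : Set (EuclideanSpace ℝ (Fin 3))) : ℝ :=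
  (MeasureTheory.Measure.euclideanHausdorffMeasure 2 (convexHull ℝ P)).toReal

/-- Volume of the (possibly degenerate) tetrahedron with vertices `T 0, T 1, T 2, T 3`: the
Lebesgue measure of their convex hull. -/
noncomputable def tetrahedronVolume (T : Fin 4 → EuclideanSpace ℝ (Fin 3)) : ℝ :=
  (MeasureTheory.volume (convexHull ℝ (Set.range T))).toReal

/-- A tetrahedron in Euclidean 3-space, given by its vertices, is Heronian if its six edge lengths
are integers, and its four face areas and its volume are rational. The tetrahedron may be
improper, that is, of zero volume. The face opposite to the vertex `T i` is spanned by the other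
three vertices. -/
structure IsHeronianTetrahedron (T : Fin 4 → EuclideanSpace ℝ (Fin 3)) : Prop where
  edge : ∀ i j, ∃ n : ℤ, dist (T i) (T j) = n
  face : ∀ i, ∃ q : ℚ, triangleArea (T '' {i}ᶜ) = q
  volume : ∃ q : ℚ, tetrahedronVolume T = q

/-! Fix a vertex and consider the edge vectors from it. Their inner products are integers: by the
law of cosines they are half-integers, and a rational face area excludes odd numerators modulo 4
(`exists_int_eq_of_two_mul_eq`). The leading minors of the Gram matrix are rational squares, namely
an edge squared, four times an area squared and 36 times the volume squared, so a triangular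
factorisation places the tetrahedron in `ℚ³` (`exists_rat_vectors_of_gram`).

The edge vectors then generate an integral lattice `L` in `ℚ³`, and
`exists_isometry_map_le_integerVectors` moves it into `ℤ³` by descent on the denominator. The
quotient `L / (L ∩ ℤ³)` is cyclic, generated by some `x` of order `e`. With `n` the nearest integer
vector and `d = x - n`, one has `d·d ≤ 3/4`, and reflecting in the plane orthogonal to `d` replaces
the denominator `e` by `e (d·d) < e`. -/

/-! ### Integral lattices modulo `ℤ³` -/

/-- The subgroup `ℤ³` of `ℚ³`. -/
def integerVectors : AddSubgroup (Fin 3 → ℚ) where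
  carrier := {x | ∀ k, ∃ m : ℤ, x k = m}
  zero_mem' := fun _ => ⟨0, by simp⟩
  add_mem' := fun {x y} hx hy k => by
    obtain ⟨m, hm⟩ := hx k
    obtain ⟨n, hn⟩ := hy k
    exact ⟨m + n, by simp [hm, hn]⟩
  neg_mem' := fun {x} hx k => by
    obtain ⟨m, hm⟩ := hx k
    exact ⟨-m, by simp [hm]⟩

theorem mem_integerVectors_iff_exists {x : Fin 3 → ℚ} :
    x ∈ integerVectors ↔ ∃ m : Fin 3 → ℤ, x = fun k => (m k : ℚ) := by
  constructor
  · intro h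
    choose m hm using h
    exact ⟨m, funext hm⟩
  · rintro ⟨m, rfl⟩ k
    exact ⟨m k, rfl⟩

theorem exists_int_eq_dotProduct {x y : Fin 3 → ℚ} (hx : x ∈ integerVectors)
    (hy : y ∈ integerVectors) : ∃ m : ℤ, x ⬝ᵥ y = m := by
  obtain ⟨m, rfl⟩ := mem_integerVectors_iff_exists.1 hx
  obtain ⟨n, rfl⟩ := mem_integerVectors_iff_exists.1 hy
  exact ⟨m ⬝ᵥ n, by simp [dotProduct]⟩

/-- A totally isotropic pair of vectors modulo `e ^ 2`, the first of them unimodular, is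
linearly dependent modulo `e`. -/
theorem exists_dvd_sub_mul_of_isotropic {e : ℤ} {X Y a : Fin 3 → ℤ} {c : ℤ}
    (ha : a ⬝ᵥ X + e * c = 1) (hXX : e ^ 2 ∣ X ⬝ᵥ X) (hXY : e ^ 2 ∣ X ⬝ᵥ Y)
    (hYY : e ^ 2 ∣ Y ⬝ᵥ Y) : ∃ r : ℤ, ∀ k, e ∣ Y k - r * X k := by
  -- Lift the inverse from modulus `e` to `e ^ 2`: `(1 + ec)(1 - ec) = 1 - e²c²`.
  obtain ⟨b, hb⟩ : ∃ b : Fin 3 → ℤ, b ⬝ᵥ X = 1 - e ^ 2 * c ^ 2 := by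
    refine ⟨(1 + e * c) • a, ?_⟩
    rw [smul_dotProduct, smul_eq_mul]
    linear_combination (1 + e * c) * ha
  obtain ⟨s, hs⟩ := hXX
  obtain ⟨r, hr⟩ := hXY
  obtain ⟨t, ht⟩ := hYY
  simp only [dotProduct, Fin.sum_univ_three] at hb hs hr ht
  obtain ⟨w₀, hw₀⟩ : ∃ w, w = X 1 * Y 2 - X 2 * Y 1 := ⟨_, rfl⟩
  obtain ⟨w₁, hw₁⟩ : ∃ w, w = X 2 * Y 0 - X 0 * Y 2 := ⟨_, rfl⟩
  obtain ⟨w₂, hw₂⟩ : ∃ w, w = X 0 * Y 1 - X 1 * Y 0 := ⟨_, rfl⟩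
  obtain ⟨μ, hμ⟩ : ∃ μ, μ = b 0 * w₀ + b 1 * w₁ + b 2 * w₂ := ⟨_, rfl⟩
  -- The cross product of `X` and `Y` is congruent to `μ X` modulo `e ^ 2`.
  obtain ⟨E₀, h₀⟩ : ∃ E, w₀ = μ * X 0 + e ^ 2 * E :=
    ⟨c ^ 2 * w₀ - (b 1 * (r * X 2 - s * Y 2) - b 2 * (r * X 1 - s * Y 1)), by
      linear_combination X 0 * hμ.symm - w₀ * hb - b 1 * (X 2 * hr - Y 2 * hs)
        + b 2 * (X 1 * hr - Y 1 * hs) + (X 1 * b 1 + X 2 * b 2) * hw₀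
        - X 0 * (b 1 * hw₁ + b 2 * hw₂)⟩
  obtain ⟨E₁, h₁⟩ : ∃ E, w₁ = μ * X 1 + e ^ 2 * E :=
    ⟨c ^ 2 * w₁ - (b 2 * (r * X 0 - s * Y 0) - b 0 * (r * X 2 - s * Y 2)), by
      linear_combination X 1 * hμ.symm - w₁ * hb - b 2 * (X 0 * hr - Y 0 * hs)
        + b 0 * (X 2 * hr - Y 2 * hs) + (X 2 * b 2 + X 0 * b 0) * hw₁
        - X 1 * (b 2 * hw₂ + b 0 * hw₀)⟩
  obtain ⟨E₂, h₂⟩ : ∃ E, w₂ = μ * X 2 + e ^ 2 * E :=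
    ⟨c ^ 2 * w₂ - (b 0 * (r * X 1 - s * Y 1) - b 1 * (r * X 0 - s * Y 0)), by
      linear_combination X 2 * hμ.symm - w₂ * hb - b 0 * (X 1 * hr - Y 1 * hs)
        + b 1 * (X 0 * hr - Y 0 * hs) + (X 0 * b 0 + X 1 * b 1) * hw₂
        - X 2 * (b 0 * hw₀ + b 1 * hw₁)⟩
  -- Modulo `e ^ 2`, `Y × (X × Y) = (Y·Y) X - (X·Y) Y` vanishes, while `X × Y ≡ μ X` turns it into
  -- `-μ² X`. Pair with `b`.
  have hdvd : e ^ 2 ∣ μ ^ 2 := by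
    refine ⟨b 0 * (Y 1 * E₂ - Y 2 * E₁) + b 1 * (Y 2 * E₀ - Y 0 * E₂)
      + b 2 * (Y 0 * E₁ - Y 1 * E₀) - (b 0 * (t * X 0 - r * Y 0) + b 1 * (t * X 1 - r * Y 1)
        + b 2 * (t * X 2 - r * Y 2)), ?_⟩
    linear_combination μ * hμ + μ * (b 0 * hw₀ + b 1 * hw₁ + b 2 * hw₂)
      + b 0 * (Y 1 * (h₂ - hw₂) - Y 2 * (h₁ - hw₁)) + b 1 * (Y 2 * (h₀ - hw₀) - Y 0 * (h₂ - hw₂))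
      + b 2 * (Y 0 * (h₁ - hw₁) - Y 1 * (h₀ - hw₀)) - b 0 * (X 0 * ht - Y 0 * hr)
      - b 1 * (X 1 * ht - Y 1 * hr) - b 2 * (X 2 * ht - Y 2 * hr)
  obtain ⟨f, rfl⟩ : e ∣ μ := (Int.pow_dvd_pow_iff two_ne_zero).1 hdvd
  -- Now `X × Y ≡ 0` modulo `e`, and `b × (X × Y) = (b·Y) X - (b·X) Y` with `b·X ≡ 1`.
  refine ⟨b 0 * Y 0 + b 1 * Y 1 + b 2 * Y 2, fun k => ?_⟩
  fin_cases k
  · refine ⟨e * c ^ 2 * Y 0 - (b 1 * (f * X 2 + e * E₂) - b 2 * (f * X 1 + e * E₁)), ?_⟩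
    change Y 0 - _ * X 0 = _
    linear_combination -Y 0 * hb - b 1 * (h₂ - hw₂) + b 2 * (h₁ - hw₁)
  · refine ⟨e * c ^ 2 * Y 1 - (b 2 * (f * X 0 + e * E₀) - b 0 * (f * X 2 + e * E₂)), ?_⟩
    change Y 1 - _ * X 1 = _
    linear_combination -Y 1 * hb - b 2 * (h₀ - hw₀) + b 0 * (h₂ - hw₂)
  · refine ⟨e * c ^ 2 * Y 2 - (b 0 * (f * X 1 + e * E₁) - b 1 * (f * X 0 + e * E₀)), ?_⟩
    change Y 2 - _ * X 2 = _
    linear_combination -Y 2 * hb - b 0 * (h₁ - hw₁) + b 1 * (h₀ - hw₀)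

/-- Some element of an integral lattice generates it modulo its integer vectors. -/
theorem exists_generator_mod_integerVectors {L : AddSubgroup (Fin 3 → ℚ)}
    (hL : ∀ x ∈ L, ∀ y ∈ L, ∃ m : ℤ, x ⬝ᵥ y = m) {t : ℕ} (ht : 0 < t)
    (htL : ∀ x ∈ L, t • x ∈ integerVectors) :
    ∃ e : ℕ, 0 < e ∧ e ≤ t ∧ ∃ x ∈ L,
      ∀ y ∈ L, e • y ∈ integerVectors ∧ ∃ c : ℤ, y - c • x ∈ integerVectors := by
  let π := QuotientAddGroup.mk' integerVectors
  have hπ : ∀ x, π x = 0 ↔ x ∈ integerVectors := fun x => QuotientAddGroup.eq_zero_iff x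
  let G := L.map π
  have hexp : ∀ g : G, t • g = 0 := by
    rintro ⟨_, x, hx, rfl⟩
    ext
    change t • π x = 0
    rw [← map_nsmul, hπ]
    exact htL x hx
  have hE : AddMonoid.ExponentExists G := ⟨t, ht, hexp⟩
  -- An element whose order is the exponent; isotropy will show that it generates.
  obtain ⟨⟨_, x, hx, rfl⟩, hxe⟩ := AddMonoid.exists_addOrderOf_eq_exponent hE
  rw [← AddSubgroup.addOrderOf_coe] at hxe
  set e := AddMonoid.exponent G with he
  have hepos : 0 < e := hE.exponent_pos
  have hord : ∀ n : ℕ, n • x ∈ integerVectors ↔ e ∣ n := fun n => by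
    rw [← hπ, map_nsmul, ← hxe, addOrderOf_dvd_iff_nsmul_eq_zero]
  have heL : ∀ y ∈ L, e • y ∈ integerVectors := fun y hy => by
    rw [← hπ, map_nsmul]
    exact congrArg Subtype.val
      (AddMonoid.exponent_nsmul_eq_zero (⟨π y, y, hy, rfl⟩ : G))
  have he0 : (e : ℚ) ≠ 0 := by exact_mod_cast hepos.ne'
  refine ⟨e, hepos, Nat.le_of_dvd ht (AddMonoid.exponent_dvd_of_forall_nsmul_eq_zero hexp),
    x, hx, fun y hy => ⟨heL y hy, ?_⟩⟩
  obtain ⟨X, hX⟩ := mem_integerVectors_iff_exists.1 (heL x hx)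
  obtain ⟨Y, hY⟩ := mem_integerVectors_iff_exists.1 (heL y hy)
  have hdvd : ∀ {u v : Fin 3 → ℚ} {U V : Fin 3 → ℤ}, u ∈ L → v ∈ L →
      (e • u = fun k => (U k : ℚ)) → (e • v = fun k => (V k : ℚ)) → (e : ℤ) ^ 2 ∣ U ⬝ᵥ V := by
    intro u v U V hu hv hU hV
    obtain ⟨m, hm⟩ := hL u hu v hv
    refine ⟨m, ?_⟩
    have : ((U ⬝ᵥ V : ℤ) : ℚ) = (e • u) ⬝ᵥ (e • v) := by
      rw [hU, hV]; simp [dotProduct]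
    rw [smul_dotProduct, dotProduct_smul, hm] at this
    simp only [nsmul_eq_mul] at this
    have h2 : ((U ⬝ᵥ V : ℤ) : ℚ) = ((e ^ 2 * m : ℤ) : ℚ) := by
      rw [this]; push_cast; ring
    exact_mod_cast h2
  -- A common divisor `g` of `e` and the entries of `X = e x` makes `(e / g) x` integral; as `x` has
  -- order `e`, `g` is a unit.
  obtain ⟨a, c, hac⟩ : ∃ (a : Fin 3 → ℤ) (c : ℤ), a ⬝ᵥ X + e * c = 1 := by
    let I : Ideal ℤ := Ideal.span {X 0, X 1, X 2, (e : ℤ)}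
    obtain ⟨g, hg⟩ := (IsPrincipalIdealRing.principal I).principal
    have hgd : ∀ z ∈ I, g ∣ z := fun z hz => by
      rw [hg] at hz; exact Ideal.mem_span_singleton.1 hz
    obtain ⟨f, hf⟩ : g ∣ (e : ℤ) := hgd _ (Ideal.subset_span (by simp))
    have hgX : ∀ k, g ∣ X k := fun k => hgd _ (Ideal.subset_span (by fin_cases k <;> simp))
    have hf0 : (f : ℚ) ≠ 0 := fun h => by
      have h0 : f = 0 := by exact_mod_cast h
      rw [h0] at hf
      omega
    have hefab : f.natAbs • x ∈ integerVectors := by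
      have h1 : f • x ∈ integerVectors := fun k => by
        obtain ⟨q, hq⟩ := hgX k
        refine ⟨q, ?_⟩
        have h2 := congrFun hX k
        rw [hq] at h2
        simp only [Pi.smul_apply, nsmul_eq_mul, zsmul_eq_mul] at h2 ⊢
        have h3 : (e : ℚ) = g * f := by exact_mod_cast hf
        have hg0 : (g : ℚ) ≠ 0 := fun h => he0 (by rw [h3, h, zero_mul])
        rw [h3] at h2
        push_cast at h2
        apply mul_left_cancel₀ hg0
        rw [← h2]; ring
      rcases Int.natAbs_eq f with h | h
      · rw [h, natCast_zsmul] at h1; exact h1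
      · rw [h, neg_smul, natCast_zsmul] at h1; exact neg_mem_iff.1 h1
    have hef : (e : ℤ) ∣ f := Int.natCast_dvd.2 ((hord _).1 hefab)
    have hone : IsUnit g := by
      obtain ⟨u, hu⟩ := hef
      have hez : (e : ℤ) ≠ 0 := by exact_mod_cast hepos.ne'
      refine IsUnit.of_mul_eq_one u (mul_left_cancel₀ hez ?_)
      rw [mul_one]
      nth_rewrite 2 [hf]
      rw [hu]; ring
    have h1 : (1 : ℤ) ∈ I := by
      rw [hg]; exact Ideal.mem_span_singleton.2 hone.dvd
    simp only [I, Ideal.mem_span_insert, Ideal.mem_span_singleton] at h1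
    obtain ⟨a₀, z, ⟨a₁, z', ⟨a₂, z'', ⟨c, rfl⟩, rfl⟩, rfl⟩, h⟩ := h1
    refine ⟨![a₀, a₁, a₂], c, ?_⟩
    simp only [dotProduct, Fin.sum_univ_three, Matrix.cons_val]
    linear_combination -h
  obtain ⟨r, hr⟩ := exists_dvd_sub_mul_of_isotropic hac (hdvd hx hx hX hX) (hdvd hx hy hX hY)
    (hdvd hy hy hY hY)
  refine ⟨r, fun k => ?_⟩
  obtain ⟨q, hq⟩ := hr k
  refine ⟨q, mul_left_cancel₀ he0 ?_⟩
  have h1 := congrFun hX k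
  have h2 := congrFun hY k
  have h3 : (Y k : ℚ) - r * X k = e * q := by exact_mod_cast hq
  simp only [Pi.smul_apply, Pi.sub_apply] at h1 h2 ⊢
  simp only [nsmul_eq_mul, zsmul_eq_mul] at h1 h2 ⊢
  rw [← h3, ← h1, ← h2]; ring

/-! ### Descent by reflections -/

/-- The reflection of `ℚ³` in the plane orthogonal to `d`. -/
def rationalReflection (d : Fin 3 → ℚ) : (Fin 3 → ℚ) →ₗ[ℚ] (Fin 3 → ℚ) where
  toFun x := x - (2 * (x ⬝ᵥ d) / (d ⬝ᵥ d)) • d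
  map_add' x y := by
    ext k
    simp only [add_dotProduct, Pi.sub_apply, Pi.add_apply, Pi.smul_apply, smul_eq_mul]
    ring
  map_smul' r x := by
    ext k
    simp only [smul_dotProduct, Pi.sub_apply, Pi.smul_apply, smul_eq_mul, RingHom.id_apply]
    ring

theorem rationalReflection_apply (d x : Fin 3 → ℚ) :
    rationalReflection d x = x - (2 * (x ⬝ᵥ d) / (d ⬝ᵥ d)) • d := rfl

theorem rationalReflection_dotProduct (d : Fin 3 → ℚ) (hd : d ⬝ᵥ d ≠ 0) (x y : Fin 3 → ℚ) :
    rationalReflection d x ⬝ᵥ rationalReflection d y = x ⬝ᵥ y := by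
  simp only [rationalReflection_apply, sub_dotProduct, dotProduct_sub, smul_dotProduct,
    dotProduct_smul, smul_eq_mul, dotProduct_comm d y]
  field_simp
  ring

/-- An integral lattice in `ℚ³` that has bounded denominators is carried into `ℤ³` by a rational
isometry. -/
theorem exists_isometry_map_le_integerVectors (t : ℕ) (ht : 0 < t)
    (L : AddSubgroup (Fin 3 → ℚ)) (hL : ∀ x ∈ L, ∀ y ∈ L, ∃ m : ℤ, x ⬝ᵥ y = m)
    (htL : ∀ x ∈ L, t • x ∈ integerVectors) :
    ∃ φ : (Fin 3 → ℚ) →ₗ[ℚ] (Fin 3 → ℚ), (∀ x y, φ x ⬝ᵥ φ y = x ⬝ᵥ y) ∧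
      ∀ x ∈ L, φ x ∈ integerVectors := by
  induction t using Nat.strong_induction_on generalizing L with
  | _ t ih =>
  obtain ⟨e, he, het, x, hx, hgen⟩ := exists_generator_mod_integerVectors hL ht htL
  by_cases hx1 : x ∈ integerVectors
  · refine ⟨LinearMap.id, fun _ _ => rfl, fun y hy => ?_⟩
    obtain ⟨-, c, hc⟩ := hgen y hy
    simpa using add_mem hc (zsmul_mem hx1 c)
  obtain ⟨n, hn⟩ : ∃ n : Fin 3 → ℚ, n = fun k => ((round (x k) : ℤ) : ℚ) := ⟨_, rfl⟩
  have hnZ : n ∈ integerVectors := mem_integerVectors_iff_exists.2 ⟨_, hn⟩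
  obtain ⟨d, hd⟩ : ∃ d, d = x - n := ⟨_, rfl⟩
  have hd0 : d ⬝ᵥ d ≠ 0 := fun h => hx1 <| by
    rw [dotProduct_self_eq_zero, hd, sub_eq_zero] at h
    rwa [h]
  have hdpos : 0 < d ⬝ᵥ d := lt_of_le_of_ne (by
    simp only [dotProduct]; exact Finset.sum_nonneg fun i _ => mul_self_nonneg _) hd0.symm
  have hdlt : d ⬝ᵥ d < 1 := by
    have h : ∀ k, d k * d k ≤ 1 / 4 := fun k => by
      have := abs_le.1 (abs_sub_round (x k))
      have h2 : d k = x k - round (x k) := by simp [hd, hn]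
      rw [h2]; nlinarith
    simp only [dotProduct, Fin.sum_univ_three]
    linarith [h 0, h 1, h 2]
  have hed : e • d ∈ integerVectors := by
    rw [hd, nsmul_sub]; exact sub_mem (hgen x hx).1 (nsmul_mem hnZ e)
  have hxx := hL x hx x hx
  have hnn := exists_int_eq_dotProduct hnZ hnZ
  have hdd : d ⬝ᵥ d = x ⬝ᵥ x - 2 * (x ⬝ᵥ n) + n ⬝ᵥ n := by
    rw [hd]; simp only [sub_dotProduct, dotProduct_sub, dotProduct_comm n x]; ring
  have hxd : 2 * (x ⬝ᵥ d) = x ⬝ᵥ x + d ⬝ᵥ d - n ⬝ᵥ n := by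
    rw [hdd, hd, dotProduct_sub]; ring
  -- The new denominator; it is integral because `e x`, `n` and `x·x` are.
  obtain ⟨s, hs⟩ : ∃ s : ℕ, e * (d ⬝ᵥ d) = s := by
    obtain ⟨a, ha⟩ := hxx
    obtain ⟨b, hb⟩ := hnn
    obtain ⟨c, hc⟩ := exists_int_eq_dotProduct (hgen x hx).1 hnZ
    rw [smul_dotProduct, nsmul_eq_mul] at hc
    have h1 : (e : ℚ) * (d ⬝ᵥ d) = ((e * a - 2 * c + e * b : ℤ) : ℚ) := by
      rw [hdd, ha, hb]; push_cast; linear_combination -2 * hc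
    have h2 : (0 : ℤ) ≤ e * a - 2 * c + e * b := by
      have : (0 : ℚ) ≤ ((e * a - 2 * c + e * b : ℤ) : ℚ) := by rw [← h1]; positivity
      exact_mod_cast this
    lift (e * a - 2 * c + e * b : ℤ) to ℕ using h2 with s
    exact ⟨s, by rw [h1]; simp⟩
  have heQ : (0 : ℚ) < e := by exact_mod_cast he
  have hspos : 0 < s := by
    have : (0 : ℚ) < s := by rw [← hs]; positivity
    exact_mod_cast this
  have hse : s < e := by
    have : (s : ℚ) < e := by rw [← hs]; nlinarith
    exact_mod_cast this
  have hR : ∀ y, s • rationalReflection d y = s • y - (2 * (y ⬝ᵥ d)) • (e • d) := fun y => by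
    rw [rationalReflection_apply, nsmul_sub]
    congr 1
    rw [← Nat.cast_smul_eq_nsmul ℚ, ← Nat.cast_smul_eq_nsmul ℚ, smul_smul, smul_smul, ← hs]
    congr 1
    field_simp
  -- Since `2 (x·d) = x·x - n·n + d·d` and `e (d·d) = s`, the non-integral part `s x - s d`
  -- collapses to `s n`.
  have hRx : s • rationalReflection d x ∈ integerVectors := by
    obtain ⟨a, ha⟩ := hxx
    obtain ⟨b, hb⟩ := hnn
    have : s • rationalReflection d x = s • n - (a - b) • (e • d) := by
      rw [hR, hxd, ha, hb]
      ext k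
      have h2 : d k = x k - n k := by simp [hd]
      simp only [Pi.sub_apply, Pi.smul_apply]
      simp only [smul_eq_mul, nsmul_eq_mul, zsmul_eq_mul]
      push_cast
      rw [← hs]
      linear_combination (-(e : ℚ) * (d ⬝ᵥ d)) * h2
    rw [this]
    exact sub_mem (nsmul_mem hnZ s) (zsmul_mem hed _)
  obtain ⟨φ, hφ, hφL⟩ := ih s (hse.trans_le het) hspos
    (L.map (rationalReflection d).toAddMonoidHom) (by
      rintro _ ⟨y, hy, rfl⟩ _ ⟨z, hz, rfl⟩
      obtain ⟨m, hm⟩ := hL y hy z hz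
      exact ⟨m, (rationalReflection_dotProduct d hd0 y z).trans hm⟩) (by
      rintro _ ⟨y, hy, rfl⟩
      change s • rationalReflection d y ∈ integerVectors
      obtain ⟨-, c, hc⟩ := hgen y hy
      obtain ⟨z, hz⟩ : ∃ z, z = y - c • x := ⟨_, rfl⟩
      rw [← hz] at hc
      have hzL : z ∈ L := hz ▸ sub_mem hy (zsmul_mem hx c)
      have hyz : y = z + c • x := by rw [hz]; abel
      rw [hyz, map_add, nsmul_add, map_zsmul, smul_comm]
      refine add_mem ?_ (zsmul_mem hRx c)
      -- Both `z·x` and `z·n` are integers, as `z` lies in `L` and in `ℤ³`.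
      obtain ⟨m, hm⟩ : ∃ m : ℤ, z ⬝ᵥ d = m := by
        obtain ⟨a, ha⟩ := hL z hzL x hx
        obtain ⟨b, hb⟩ := exists_int_eq_dotProduct hc hnZ
        exact ⟨a - b, by rw [hd, dotProduct_sub, ha, hb]; push_cast; rfl⟩
      rw [hR, hm]
      have : (2 * (m : ℚ)) • (e • d) = (2 * m) • (e • d) := by
        rw [← Int.cast_smul_eq_zsmul ℚ]; push_cast; rfl
      rw [this]
      exact sub_mem (nsmul_mem hc s) (zsmul_mem hed _))
  exact ⟨φ ∘ₗ rationalReflection d,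
    fun y z => (hφ _ _).trans (rationalReflection_dotProduct d hd0 y z),
    fun y hy => hφL _ ⟨y, hy, rfl⟩⟩

/-- A finite family of rational vectors with integral dot products is carried into `ℤ³` by a
rational isometry. -/
theorem exists_isometry_forall_mem_integerVectors {ι : Type*} [Finite ι] (p : ι → Fin 3 → ℚ)
    (hp : ∀ i j, ∃ m : ℤ, p i ⬝ᵥ p j = m) :
    ∃ φ : (Fin 3 → ℚ) →ₗ[ℚ] (Fin 3 → ℚ), (∀ x y, φ x ⬝ᵥ φ y = x ⬝ᵥ y) ∧
      ∀ i, φ (p i) ∈ integerVectors := by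
  have := Fintype.ofFinite ι
  obtain ⟨φ, hφ, h⟩ := exists_isometry_map_le_integerVectors
    (∏ i, ∏ k, (p i k).den) (Finset.prod_pos fun i _ => Finset.prod_pos fun k _ => (p i k).den_pos)
    (AddSubgroup.closure (Set.range p)) (fun x hx y hy => by
      induction hx, hy using AddSubgroup.closure_induction₂ with
      | mem x y hx hy =>
        obtain ⟨i, rfl⟩ := hx
        obtain ⟨j, rfl⟩ := hy
        exact hp i j
      | zero_left x hx => exact ⟨0, by simp⟩
      | zero_right x hx => exact ⟨0, by simp⟩
      | add_left x y z hx hy hz h₁ h₂ =>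
        obtain ⟨a, ha⟩ := h₁
        obtain ⟨b, hb⟩ := h₂
        exact ⟨a + b, by rw [add_dotProduct, ha, hb]; push_cast; rfl⟩
      | add_right y z x hy hz hx h₁ h₂ =>
        obtain ⟨a, ha⟩ := h₁
        obtain ⟨b, hb⟩ := h₂
        exact ⟨a + b, by rw [dotProduct_add, ha, hb]; push_cast; rfl⟩
      | neg_left x y hx hy h =>
        obtain ⟨a, ha⟩ := h
        exact ⟨-a, by rw [neg_dotProduct, ha]; push_cast; rfl⟩
      | neg_right x y hx hy h =>
        obtain ⟨a, ha⟩ := h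
        exact ⟨-a, by rw [dotProduct_neg, ha]; push_cast; rfl⟩) (fun x hx => by
      induction hx using AddSubgroup.closure_induction with
      | mem x hx =>
        obtain ⟨i, rfl⟩ := hx
        intro k
        obtain ⟨c, hc⟩ : (p i k).den ∣ ∏ i, ∏ k, (p i k).den :=
          (Finset.dvd_prod_of_mem (fun k => (p i k).den) (Finset.mem_univ k)).trans
            (Finset.dvd_prod_of_mem (fun i => ∏ k, (p i k).den) (Finset.mem_univ i))
        refine ⟨c * (p i k).num, ?_⟩
        rw [hc, Pi.smul_apply, nsmul_eq_mul]
        push_cast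
        rw [← Rat.mul_den_eq_num]; ring
      | zero => simp [zero_mem]
      | add x y hx hy h₁ h₂ => rw [nsmul_add]; exact add_mem h₁ h₂
      | neg x hx h => rw [smul_neg]; exact neg_mem h)
  exact ⟨φ, hφ, fun i => h _ (AddSubgroup.subset_closure ⟨i, rfl⟩)⟩

/-! ### Content of simplices and Gram determinants -/

-- Fubini in the first coordinate: the slice at `s` is the simplex of size `r - s` one dimension
-- lower, so the induction needs all `r`.
open MeasureTheory in
theorem volume_setOf_nonneg_sum_le (d : ℕ) {r : ℝ} (hr : 0 ≤ r) :
    volume {x : Fin d → ℝ | (∀ i, 0 ≤ x i) ∧ ∑ i, x i ≤ r} =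
      ENNReal.ofReal (r ^ d / d.factorial) := by
  induction d generalizing r with
  | zero => simp [hr, volume_pi]
  | succ d ih =>
    let S : Set (ℝ × (Fin d → ℝ)) := {z | 0 ≤ z.1 ∧ (∀ i, 0 ≤ z.2 i) ∧ z.1 + ∑ i, z.2 i ≤ r}
    have hS : MeasurableSet S := by
      refine IsClosed.measurableSet ?_
      refine (isClosed_le continuous_const continuous_fst).inter (IsClosed.inter ?_ ?_)
      · exact isClosed_Ici.preimage continuous_snd
      · exact isClosed_le (f := fun z : ℝ × (Fin d → ℝ) => z.1 + ∑ i, z.2 i) (by fun_prop)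
          continuous_const
    have hpre : {x : Fin (d + 1) → ℝ | (∀ i, 0 ≤ x i) ∧ ∑ i, x i ≤ r} =
        MeasurableEquiv.piFinSuccAbove (fun _ => ℝ) 0 ⁻¹' S := by
      ext x
      simp [S, MeasurableEquiv.piFinSuccAbove, Fin.insertNthEquiv, Fin.forall_fin_succ,
        Fin.sum_univ_succ, and_assoc, Fin.tail]
    have hslice : ∀ s : ℝ, volume (Prod.mk s ⁻¹' S) =
        (Set.Icc 0 r).indicator
          (fun s => ENNReal.ofReal ((r - s) ^ d / d.factorial)) s := fun s => by
      by_cases hs : s ∈ Set.Icc 0 r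
      · rw [Set.indicator_of_mem hs, ← ih (sub_nonneg.2 hs.2)]
        congr 1
        ext y
        simp [S, hs.1, le_sub_iff_add_le']
      · rw [Set.indicator_of_notMem hs]
        convert! measure_empty (μ := volume)
        ext y
        simp only [S, Set.mem_preimage, Set.mem_ofPred_eq, Set.mem_empty_iff_false, iff_false]
        rintro ⟨h1, h2, h3⟩
        exact hs ⟨h1, by linarith [Finset.sum_nonneg fun i (_ : i ∈ Finset.univ) => h2 i]⟩
    rw [hpre, (volume_preserving_piFinSuccAbove (fun _ => ℝ) 0).measure_preimage
      hS.nullMeasurableSet, Measure.volume_eq_prod, Measure.prod_apply hS]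
    simp_rw [hslice]
    rw [lintegral_indicator measurableSet_Icc, ← ofReal_integral_eq_lintegral_ofReal]
    · congr 1
      rw [integral_Icc_eq_integral_Ioc, ← intervalIntegral.integral_of_le hr,
        intervalIntegral.integral_div,
        intervalIntegral.integral_comp_sub_left (fun x => x ^ d) r, integral_pow,
        Nat.factorial_succ]
      push_cast
      field_simp
      simp
    · exact (Continuous.integrableOn_Icc (by fun_prop))
    · filter_upwards [ae_restrict_mem measurableSet_Icc] with s hs
      have : 0 ≤ r - s := sub_nonneg.2 hs.2
      positivity

theorem convexHull_insert_zero_range_basisFun (d : ℕ) :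
    convexHull ℝ (insert 0 (Set.range (EuclideanSpace.basisFun (Fin d) ℝ))) =
      {x | (∀ i, 0 ≤ x i) ∧ ∑ i, x i ≤ 1} := by
  apply Set.Subset.antisymm
  · refine convexHull_min ?_ ?_
    · rintro _ (rfl | ⟨i, rfl⟩)
      · simp
      · refine ⟨fun j => ?_, ?_⟩
        · by_cases h : j = i <;> simp [h]
        · simp
    · intro x hx y hy a b ha hb hab
      refine ⟨fun i => ?_, ?_⟩
      · simpa using add_nonneg (mul_nonneg ha (hx.1 i)) (mul_nonneg hb (hy.1 i))
      · simp only [PiLp.add_apply, PiLp.smul_apply, smul_eq_mul, Finset.sum_add_distrib,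
          ← Finset.mul_sum]
        nlinarith [mul_le_mul_of_nonneg_left hx.2 ha, mul_le_mul_of_nonneg_left hy.2 hb]
  · rintro x ⟨hx, hx1⟩
    have h := (convex_convexHull ℝ
      (insert 0 (Set.range (EuclideanSpace.basisFun (Fin d) ℝ)))).sum_mem
      (t := Finset.univ) (w := fun o : Option (Fin d) => o.elim (1 - ∑ i, x i) fun i => x i)
      (z := fun o => o.elim 0 fun i => EuclideanSpace.basisFun (Fin d) ℝ i)
      (by rintro (_ | i) -
          · exact sub_nonneg.2 hx1
          · exact hx i)
      (by simp [Fintype.sum_option])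
      (by rintro (_ | i) -
          · exact subset_convexHull ℝ _ (Set.mem_insert _ _)
          · exact subset_convexHull ℝ _ (Set.mem_insert_of_mem _ ⟨i, rfl⟩))
    convert! h
    rw [Fintype.sum_option]
    simp only [Option.elim_none, Option.elim_some, smul_zero, zero_add]
    exact ((EuclideanSpace.basisFun (Fin d) ℝ).sum_repr x).symm

open MeasureTheory in
theorem volume_convexHull_insert_zero_range_basisFun (d : ℕ) :
    volume (convexHull ℝ (insert 0 (Set.range (EuclideanSpace.basisFun (Fin d) ℝ)))) =
      ENNReal.ofReal (1 / d.factorial) := by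
  have h := volume_setOf_nonneg_sum_le d zero_le_one
  rw [← (PiLp.volume_preserving_ofLp (Fin d)).measure_preimage_emb
    (MeasurableEquiv.toLp 2 (Fin d → ℝ)).symm.measurableEmbedding] at h
  rw [convexHull_insert_zero_range_basisFun]
  simpa using h

open MeasureTheory in
/-- The squared content of a simplex in terms of the Gram determinant of its edge vectors. -/
theorem toReal_euclideanHausdorffMeasure_convexHull_sq {d : ℕ} {E : Type*}
    [NormedAddCommGroup E] [InnerProductSpace ℝ E] [MeasurableSpace E] [BorelSpace E]
    (p : E) (v : Fin d → E) :
    ((Measure.euclideanHausdorffMeasure d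
      (convexHull ℝ (insert p (Set.range fun i => p + v i)))).toReal * d.factorial) ^ 2 =
      (Matrix.gram ℝ v).det := by
  let f : EuclideanSpace ℝ (Fin d) →ₗ[ℝ] E :=
    (EuclideanSpace.basisFun (Fin d) ℝ).toBasis.constr ℝ v
  have hf : ∀ i, f (EuclideanSpace.basisFun (Fin d) ℝ i) = v i := fun i => by
    simp [f]
  have himage : convexHull ℝ (insert p (Set.range fun i => p + v i)) =
      (IsometryEquiv.addLeft p) '' (f '' convexHull ℝ
        (insert 0 (Set.range (EuclideanSpace.basisFun (Fin d) ℝ)))) := by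
    rw [f.image_convexHull, Set.image_insert_eq, ← Set.range_comp, map_zero]
    have h1 : (f ∘ EuclideanSpace.basisFun (Fin d) ℝ) = v := funext hf
    rw [h1]
    have h2 := (AffineEquiv.constVAdd ℝ E p).toAffineMap.image_convexHull (insert 0 (Set.range v))
    rw [Set.image_insert_eq, ← Set.range_comp] at h2
    simpa [Function.comp_def] using h2.symm
  have hμ := f.euclideanHausdorffMeasure_image_eq_normDet_mul_volume
    (convexHull ℝ (insert 0 (Set.range (EuclideanSpace.basisFun (Fin d) ℝ))))
  rw [finrank_euclideanSpace_fin, volume_convexHull_insert_zero_range_basisFun] at hμ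
  have hdet := f.normDet_sq_eq_det_gram (EuclideanSpace.basisFun (Fin d) ℝ)
  simp only [hf] at hdet
  rw [himage, (IsometryEquiv.addLeft p).isometry.euclideanHausdorffMeasure_image, hμ,
    ENNReal.toReal_mul, ENNReal.toReal_ofReal f.normDet_nonneg,
    ENNReal.toReal_ofReal (by positivity), ← hdet]
  have : (d.factorial : ℝ) ≠ 0 := by positivity
  simp only [RCLike.ofReal_real_eq_id, id_eq]
  field_simp

/-! ### Integral Gram matrices and rational coordinates -/

open scoped RealInnerProductSpace

theorem dist_sq_eq_inner_sub (x y z : EuclideanSpace ℝ (Fin 3)) :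
    dist x y ^ 2 = ⟪x - z, x - z⟫ - 2 * ⟪x - z, y - z⟫ + ⟪y - z, y - z⟫ := by
  rw [dist_eq_norm, ← sub_sub_sub_cancel_right x y z, norm_sub_sq_real,
    real_inner_self_eq_norm_sq, real_inner_self_eq_norm_sq]

/-- If the sides of a triangle are integers and its area is rational, the inner product of two of
its edge vectors is an integer. -/
theorem exists_int_eq_of_two_mul_eq {a b c : ℤ} {q : ℚ} {x : ℝ}
    (hx : 2 * x = a ^ 2 + b ^ 2 - c ^ 2) (hq : (a : ℝ) ^ 2 * b ^ 2 - x ^ 2 = q ^ 2) :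
    ∃ m : ℤ, x = m := by
  rcases Int.even_or_odd' (a ^ 2 + b ^ 2 - c ^ 2) with ⟨m, hm | hm⟩
  · refine ⟨m, ?_⟩
    have h : (a : ℝ) ^ 2 + b ^ 2 - c ^ 2 = 2 * m := by exact_mod_cast hm
    linarith
  · exfalso
    have h : (a : ℝ) ^ 2 + b ^ 2 - c ^ 2 = 2 * m + 1 := by exact_mod_cast hm
    -- An integer congruent to 3 modulo 4 would be a rational square, hence an integer square.
    have hsq : (((4 * (a ^ 2 * b ^ 2 - m ^ 2 - m) - 1 : ℤ) : ℚ)) = (2 * q) * (2 * q) := by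
      have h2 : x = (2 * m + 1) / 2 := by linarith
      have : (((4 * (a ^ 2 * b ^ 2 - m ^ 2 - m) - 1 : ℤ) : ℝ)) = (2 * q) * (2 * q) := by
        rw [h2] at hq
        push_cast
        linear_combination 4 * hq
      exact_mod_cast this
    obtain ⟨r, hr⟩ := Rat.isSquare_intCast_iff.1 ⟨2 * q, hsq⟩
    rcases Int.even_or_odd' r with ⟨k, rfl | rfl⟩
    · have : 4 * (a ^ 2 * b ^ 2 - m ^ 2 - m - k ^ 2) = 1 := by linear_combination hr
      omega
    · have : 4 * (a ^ 2 * b ^ 2 - m ^ 2 - m - k ^ 2 - k) = 2 := by linear_combination hr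
      omega

/-- Three vectors of `ℚ³` with prescribed Gram matrix, given square roots of its leading principal
minors. -/
theorem exists_rat_vectors_of_gram {a q r g₁₂ g₁₃ g₂₂ g₂₃ g₃₃ : ℚ} (ha : a ≠ 0) (hq : q ≠ 0)
    (hq2 : a ^ 2 * g₂₂ - g₁₂ ^ 2 = q ^ 2)
    (hr2 : a ^ 2 * g₂₂ * g₃₃ - a ^ 2 * g₂₃ * g₂₃ - g₁₂ * g₁₂ * g₃₃ + g₁₂ * g₂₃ * g₁₃
      + g₁₃ * g₁₂ * g₂₃ - g₁₃ * g₂₂ * g₁₃ = r ^ 2) :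
    ∃ x y z : Fin 3 → ℚ, x ⬝ᵥ x = a ^ 2 ∧ x ⬝ᵥ y = g₁₂ ∧ x ⬝ᵥ z = g₁₃ ∧ y ⬝ᵥ y = g₂₂ ∧
      y ⬝ᵥ z = g₂₃ ∧ z ⬝ᵥ z = g₃₃ := by
  -- Triangular factorisation. Only `a` and `q` occur in denominators, so `r = 0`, a flat
  -- tetrahedron, is allowed.
  refine ⟨![a, 0, 0], ![g₁₂ / a, q / a, 0],
    ![g₁₃ / a, (g₂₃ * a ^ 2 - g₁₂ * g₁₃) / (a * q), r / q], ?_, ?_, ?_, ?_, ?_, ?_⟩ <;>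
    simp only [dotProduct, Fin.sum_univ_three, Matrix.cons_val] <;> field_simp
  · ring
  · ring
  · ring
  · linear_combination -hq2
  · ring
  · linear_combination (-a ^ 2) * hr2 + (-g₁₃ ^ 2 + a ^ 2 * g₃₃) * hq2

/-! ### Lattice placement of Heronian tetrahedra -/

namespace IsHeronianTetrahedron

variable {T : Fin 4 → EuclideanSpace ℝ (Fin 3)}

theorem comp_perm (hT : IsHeronianTetrahedron T) (σ : Equiv.Perm (Fin 4)) :
    IsHeronianTetrahedron (T ∘ σ) where
  edge i j := hT.edge _ _
  face i := by
    rw [Set.image_comp, Set.image_compl_eq σ.bijective, Set.image_singleton]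
    exact hT.face _
  volume := by
    have h : tetrahedronVolume (T ∘ σ) = tetrahedronVolume T := by
      rw [tetrahedronVolume, σ.surjective.range_comp, tetrahedronVolume]
    rw [h]
    exact hT.volume

theorem exists_rat_sq_eq_det_face (hT : IsHeronianTetrahedron T) {a b c : Fin 4} (hab : a ≠ b)
    (hac : a ≠ c) (hbc : b ≠ c) : ∃ q : ℚ,
      ⟪T b - T a, T b - T a⟫ * ⟪T c - T a, T c - T a⟫ - ⟪T b - T a, T c - T a⟫ ^ 2
        = (q : ℝ) ^ 2 := by
  -- The fourth vertex, opposite the face in question.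
  obtain ⟨i, hi⟩ : ∃ i, ∀ x, x ≠ i ↔ x = a ∨ x = b ∨ x = c := by
    revert a b c; decide
  obtain ⟨q, hq⟩ := hT.face i
  have hset : T '' {i}ᶜ =
      insert (T a) (Set.range fun j => T a + (![T b - T a, T c - T a] : Fin 2 → _) j) := by
    have h1 : ({i}ᶜ : Set (Fin 4)) = {a, b, c} := by ext x; simpa using hi x
    rw [h1]
    ext x
    simp [Set.image_insert_eq, Fin.exists_fin_two, eq_comm]
  have h := toReal_euclideanHausdorffMeasure_convexHull_sq (T a)
    (![T b - T a, T c - T a] : Fin 2 → _)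
  rw [← hset] at h
  refine ⟨q * 2, ?_⟩
  rw [triangleArea] at hq
  rw [hq, Matrix.det_fin_two] at h
  simp only [Matrix.gram_apply, Matrix.cons_val, Nat.factorial] at h
  rw [real_inner_comm (T b - T a) (T c - T a)] at h
  push_cast at h ⊢
  linear_combination -h

theorem exists_rat_sq_eq_det (hT : IsHeronianTetrahedron T) : ∃ r : ℚ,
    (Matrix.gram ℝ fun i : Fin 3 => T i.succ - T 0).det = (r : ℝ) ^ 2 := by
  obtain ⟨q, hq⟩ := hT.volume
  have hset : Set.range T = insert (T 0) (Set.range fun i : Fin 3 => T 0 + (T i.succ - T 0)) := by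
    ext x
    simp [Fin.exists_fin_succ, eq_comm]
  have h := toReal_euclideanHausdorffMeasure_convexHull_sq (T 0) fun i : Fin 3 => T i.succ - T 0
  rw [← hset, EuclideanSpace.euclideanHausdorffMeasure_eq_volume] at h
  rw [tetrahedronVolume] at hq
  refine ⟨q * 6, ?_⟩
  rw [← h, hq]
  norm_num [Nat.factorial]

theorem exists_int_eq_inner (hT : IsHeronianTetrahedron T) (a b c : Fin 4) :
    ∃ m : ℤ, ⟪T b - T a, T c - T a⟫ = m := by
  by_cases hab : a = b
  · exact ⟨0, by simp [hab]⟩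
  by_cases hac : a = c
  · exact ⟨0, by simp [hac]⟩
  obtain ⟨l, hl⟩ := hT.edge b a
  obtain ⟨m, hm⟩ := hT.edge c a
  obtain ⟨n, hn⟩ := hT.edge b c
  rw [dist_eq_norm] at hl hm
  by_cases hbc : b = c
  · subst hbc
    exact ⟨l ^ 2, by rw [real_inner_self_eq_norm_sq, hl]; push_cast; rfl⟩
  obtain ⟨q, hq⟩ := hT.exists_rat_sq_eq_det_face hab hac hbc
  have h := dist_sq_eq_inner_sub (T b) (T c) (T a)
  rw [real_inner_self_eq_norm_sq, real_inner_self_eq_norm_sq, hl, hm] at hq h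
  rw [hn] at h
  exact exists_int_eq_of_two_mul_eq (a := l) (b := m) (c := n) (by linear_combination h) hq

/-- A Heronian tetrahedron that can be placed at rational points can be placed at lattice
points. -/
theorem exists_integral_congruent (hT : IsHeronianTetrahedron T) (p : Fin 3 → Fin 3 → ℚ)
    (hp : ∀ i j, ((p i ⬝ᵥ p j : ℚ) : ℝ) = ⟪T i.succ - T 0, T j.succ - T 0⟫) :
    ∃ T' : Fin 4 → EuclideanSpace ℝ (Fin 3),
      (∀ i k, ∃ m : ℤ, T' i k = m) ∧ Congruent T T' := by
  obtain ⟨P, hP⟩ : ∃ P : Fin 4 → Fin 3 → ℚ,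
      ∀ i j, ((P i ⬝ᵥ P j : ℚ) : ℝ) = ⟪T i - T 0, T j - T 0⟫ := by
    refine ⟨Fin.cons 0 p, fun i j => ?_⟩
    cases i using Fin.cases <;> cases j using Fin.cases <;> simp [hp]
  obtain ⟨φ, hφ, hφP⟩ := exists_isometry_forall_mem_integerVectors P fun i j => by
    obtain ⟨m, hm⟩ := hT.exists_int_eq_inner 0 i j
    rw [← hP] at hm
    exact ⟨m, by exact_mod_cast hm⟩
  refine ⟨fun i => WithLp.toLp 2 fun k => (φ (P i) k : ℝ), fun i k => ?_, ?_⟩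
  · obtain ⟨m, hm⟩ := hφP i k
    exact ⟨m, by simp [hm]⟩
  · rw [congruent_iff_dist_eq]
    intro i j
    rw [← sq_eq_sq₀ dist_nonneg dist_nonneg, dist_sq_eq_inner_sub _ _ (T 0),
      dist_sq_eq_inner_sub _ _ 0, ← hP, ← hP, ← hP, ← hφ, ← hφ (P i), ← hφ (P j)]
    simp [dotProduct, PiLp.inner_apply, mul_comm, -inner_self_eq_norm_sq_to_K]

theorem exists_integral_congruent_of_det_face_ne_zero (hT : IsHeronianTetrahedron T)
    (h : ⟪T 1 - T 0, T 1 - T 0⟫ * ⟪T 2 - T 0, T 2 - T 0⟫ - ⟪T 1 - T 0, T 2 - T 0⟫ ^ 2 ≠ 0) :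
    ∃ T' : Fin 4 → EuclideanSpace ℝ (Fin 3),
      (∀ i k, ∃ m : ℤ, T' i k = m) ∧ Congruent T T' := by
  obtain ⟨q, hq⟩ := hT.exists_rat_sq_eq_det_face (a := 0) (b := 1) (c := 2) (by decide)
    (by decide) (by decide)
  obtain ⟨r, hr⟩ := hT.exists_rat_sq_eq_det
  choose g hg using hT.exists_int_eq_inner 0
  obtain ⟨a, ha⟩ := hT.edge 1 0
  rw [dist_eq_norm] at ha
  have hsymm : ∀ i j, g i j = g j i := fun i j => by
    have := real_inner_comm (T i - T 0) (T j - T 0)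
    rw [hg, hg] at this
    exact_mod_cast this.symm
  have ha2 : (g 1 1 : ℚ) = a ^ 2 := by
    have := real_inner_self_eq_norm_sq (T 1 - T 0)
    rw [hg, ha] at this
    exact_mod_cast this
  rw [hq] at h
  have hq0 : q ≠ 0 := fun h0 => h (by simp [h0])
  simp only [hg] at hq
  have hq2 : (g 1 1 : ℚ) * g 2 2 - g 1 2 ^ 2 = q ^ 2 := by exact_mod_cast hq
  have ha0 : (a : ℚ) ≠ 0 := fun h0 => hq0 <| by
    rw [ha2, h0] at hq2
    nlinarith [sq_nonneg q, sq_nonneg (g 1 2 : ℚ)]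
  rw [Matrix.det_fin_three] at hr
  simp only [Matrix.gram_apply, hg, Fin.succ_zero_eq_one, Fin.succ_one_eq_two,
    show (2 : Fin 3).succ = 3 from rfl, hsymm 2 1, hsymm 3 1, hsymm 3 2] at hr
  have hr2 : (g 1 1 : ℚ) * g 2 2 * g 3 3 - g 1 1 * g 2 3 * g 2 3 - g 1 2 * g 1 2 * g 3 3
      + g 1 2 * g 2 3 * g 1 3 + g 1 3 * g 1 2 * g 2 3 - g 1 3 * g 2 2 * g 1 3 = r ^ 2 := by
    exact_mod_cast hr
  rw [ha2] at hq2 hr2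
  obtain ⟨x, y, z, hxx, hxy, hxz, hyy, hyz, hzz⟩ := exists_rat_vectors_of_gram ha0 hq0 hq2 hr2
  rw [← ha2] at hxx
  refine hT.exists_integral_congruent ![x, y, z] fun i j => ?_
  rw [hg]
  have hmain : ![x, y, z] i ⬝ᵥ ![x, y, z] j = (g i.succ j.succ : ℚ) := by
    fin_cases i <;> fin_cases j <;>
      simp [hxx, hxy, hxz, hyy, hyz, hzz, dotProduct_comm y x, dotProduct_comm z x,
        dotProduct_comm z y, hsymm 2 1, hsymm 3 1, hsymm 3 2, show (2 : Fin 3).succ = 3 from rfl]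
  rw [hmain]
  simp

theorem exists_integral_congruent_of_det_face_eq_zero (hT : IsHeronianTetrahedron T)
    (h0 : T 1 ≠ T 0)
    (h : ∀ j, ⟪T 1 - T 0, T 1 - T 0⟫ * ⟪T j - T 0, T j - T 0⟫ = ⟪T 1 - T 0, T j - T 0⟫ ^ 2) :
    ∃ T' : Fin 4 → EuclideanSpace ℝ (Fin 3),
      (∀ i k, ∃ m : ℤ, T' i k = m) ∧ Congruent T T' := by
  choose g hg using hT.exists_int_eq_inner 0 1
  obtain ⟨a, ha⟩ := hT.edge 1 0
  rw [dist_eq_norm] at ha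
  have ha2 : ⟪T 1 - T 0, T 1 - T 0⟫ = (a : ℝ) ^ 2 := by rw [real_inner_self_eq_norm_sq, ha]
  have ha0 : (a : ℝ) ≠ 0 := by rw [← ha, norm_ne_zero_iff]; exact sub_ne_zero.2 h0
  -- Equality in Cauchy–Schwarz: all vertices lie on one line, with rational coordinates `g j / a`
  -- in arc length.
  have hpar : ∀ j, T j - T 0 = ((g j : ℝ) / a ^ 2) • (T 1 - T 0) := fun j => by
    have h1 := h j
    have h2 := hg j
    rw [ha2, h2] at h1
    generalize T 1 - T 0 = u at *
    generalize T j - T 0 = w at *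
    rw [← sub_eq_zero, ← inner_self_eq_zero (𝕜 := ℝ)]
    simp only [inner_sub_left, inner_sub_right, real_inner_smul_left, real_inner_smul_right,
      real_inner_comm u w, ha2, h2]
    field_simp
    linear_combination h1
  refine hT.exists_integral_congruent (fun i => ![g i.succ / a, 0, 0]) fun i j => ?_
  rw [hpar i.succ, hpar j.succ, inner_smul_left, inner_smul_right, ha2]
  simp [dotProduct, Fin.sum_univ_three]
  field_simp

end IsHeronianTetrahedron

theorem mainTheorem1 (T : Fin 4 → EuclideanSpace ℝ (Fin 3)) (hT : IsHeronianTetrahedron T) :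
    ∃ T' : Fin 4 → EuclideanSpace ℝ (Fin 3),
      (∀ i k, ∃ m : ℤ, T' i k = m) ∧ Congruent T T' := by
  have hperm : ∀ σ : Equiv.Perm (Fin 4),
      (∃ T' : Fin 4 → EuclideanSpace ℝ (Fin 3),
        (∀ i k, ∃ m : ℤ, T' i k = m) ∧ Congruent (T ∘ σ) T') →
      ∃ T' : Fin 4 → EuclideanSpace ℝ (Fin 3),
        (∀ i k, ∃ m : ℤ, T' i k = m) ∧ Congruent T T' := by
    rintro σ ⟨T', h1, h2⟩
    refine ⟨T' ∘ σ.symm, fun i k => h1 _ k, fun i j => ?_⟩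
    simpa using h2 (σ.symm i) (σ.symm j)
  -- Either all faces are degenerate, and the vertices are collinear or coincide, or a nondegenerate
  -- face can be renumbered to `0, 1, 2`.
  by_cases hcol : ∀ a b c, a ≠ b → a ≠ c → b ≠ c →
      ⟪T b - T a, T b - T a⟫ * ⟪T c - T a, T c - T a⟫ - ⟪T b - T a, T c - T a⟫ ^ 2 = 0
  · by_cases heq : ∀ a b, T a = T b
    · refine ⟨0, fun i k => ⟨0, by simp⟩, fun i j => ?_⟩
      simp [heq i j]
    · push Not at heq
      obtain ⟨a, b, hab⟩ := heq
      obtain ⟨σ, rfl, rfl⟩ : ∃ σ : Equiv.Perm (Fin 4), σ 1 = a ∧ σ 0 = b := by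
        have hne : a ≠ b := fun h => hab (by rw [h])
        clear hab; revert a b; decide
      refine hperm σ ((hT.comp_perm σ).exists_integral_congruent_of_det_face_eq_zero hab
        fun j => ?_)
      by_cases hj0 : j = 0
      · simp [hj0]
      by_cases hj1 : j = 1
      · rw [hj1]; ring
      exact sub_eq_zero.1 (hcol (σ 0) (σ 1) (σ j) (by simp) (by simpa [eq_comm] using hj0)
        (by simpa [eq_comm] using hj1))
  · push Not at hcol
    obtain ⟨a, b, c, hab, hac, hbc, h⟩ := hcol
    obtain ⟨σ, rfl, rfl, rfl⟩ : ∃ σ : Equiv.Perm (Fin 4), σ 0 = a ∧ σ 1 = b ∧ σ 2 = c := by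
      clear h; revert a b c; decide
    exact hperm σ ((hT.comp_perm σ).exists_integral_congruent_of_det_face_ne_zero h)
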